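/- Let $d \geq 2$ be an integer and $\zeta \in \mathbb{C}^\times$ a primitive $d$-th root of unity. Let $V=\mathbb{C}^2$ with canonical basis $(x,y)$, let $(X,Y)$ be the dual basis of $V^*$, and identify $\mathbb{C}[V\times V^*]$ with $\mathbb{C}[x,y,X,Y]$, on which $\mathrm{GL}(V)$ acts through its natural actions on $V$ (the span of $x,y$) and $V^*$ (the span of $X,Y$). For $i \in \mathbb{Z}$ put $s_i=\begin{pmatrix} 0 & \zeta^i\\ \zeta^{-i} & 0\end{pmatrix}$, and let $W=\langle s_0,s_1\rangle \subset \mathrm{GL}_2(\mathbb{C})$, the dihedral group of order $2d$. Put $$q=xy,\qquad Q=XY,\qquad \mathbf{eu}_0=xX+yY,\qquad \mathbf{a}_{i,0}=x^{d-i}Y^i+y^{d-i}X^i\quad(0\leq i\leq d).$$ Let $\Psi_k(T,T',T'')$ $(k\geq 0)$ be the polynomials given by $\Psi_0=1$, $\Psi_1=T$, $\Psi_{k+1}=T\Psi_k-T'T''\Psi_{k-1}$ for $k \geq 1$; equivalently, $\Psi_k$ is the unique polynomial with $\Psi_k(\mathbf{eu}_0,q,Q)=\dfrac{(xX)^{k+1}-(yY)^{k+1}}{xX-yY}$.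 **Theorem.** The algebra of invariants $\mathbb{C}[V\times V^*]^W$ admits the following presentation as a commutative $\mathbb{C}$-algebra. Generators: $q,\ Q,\ \mathbf{eu}_0,\ \mathbf{a}_{0,0},\ \mathbf{a}_{1,0},\dots,\mathbf{a}_{d,0}$. Relations: $$\begin{cases}\mathbf{eu}_0\,\mathbf{a}_{i,0}=q\,\mathbf{a}_{i+1,0}+Q\,\mathbf{a}_{i-1,0} & \text{for } 1\leq i\leq d-1,\\ \mathbf{a}_{i-1,0}\mathbf{a}_{j+1,0}-\mathbf{a}_{i,0}\mathbf{a}_{j,0}=(\mathbf{eu}_0^2-4qQ)\,q^{d-j-1}Q^{i-1}\,\Psi_{j-i}(\mathbf{eu}_0,q,Q) & \text{for } 1\leq i\leq j\leq d-1.\end{cases}$$ That is, the algebra homomorphism from the polynomial ring in $d+4$ variables to $\mathbb{C}[V\times V^*]$ that sends the variables to these elements has image $\mathbb{C}[V\times V^*]^W$, and its kernel is the ideal generated by the (left-hand side minus right-hand side of the) relations above. -/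

import Mathlib

namespace DihedralInvariants

open MvPolynomial

noncomputable section

/-- The reflection `s_i`, the antidiagonal matrix with entries `ζ ^ i` and `ζ ^ (-i)`. -/
def s (ζ : ℂˣ) (i : ℤ) : GL (Fin 2) ℂ where
  val := !![0, ((ζ ^ i : ℂˣ) : ℂ); ((ζ ^ (-i) : ℂˣ) : ℂ), 0]
  inv := !![0, ((ζ ^ i : ℂˣ) : ℂ); ((ζ ^ (-i) : ℂˣ) : ℂ), 0]
  val_inv := by
    rw [Matrix.mul_fin_two, Matrix.one_fin_two]
    simp [zpow_ne_zero]
  inv_val := by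
    rw [Matrix.mul_fin_two, Matrix.one_fin_two]
    simp [zpow_ne_zero]

/-- The group `W = ⟨s, t⟩` with `s = s_0` and `t = s_1`. It is the dihedral group of order `2 d`
when `ζ` is a primitive `d`-th root of unity. -/
def W (ζ : ℂˣ) : Subgroup (GL (Fin 2) ℂ) := Subgroup.closure {s ζ 0, s ζ 1}

/-- `ℂ[V × V*]` for `V = ℂ²`. The variables `Sum.inl 0, Sum.inl 1` are the canonical basis `x, y`
of `V` (linear functions on `V*`), the variables `Sum.inr 0, Sum.inr 1` are the dual basis
`X, Y` of `V*` (linear functions on `V`). -/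
abbrev Poly : Type := MvPolynomial (Fin 2 ⊕ Fin 2) ℂ

def x : Poly := MvPolynomial.X (Sum.inl 0)
def y : Poly := MvPolynomial.X (Sum.inl 1)
def X : Poly := MvPolynomial.X (Sum.inr 0)
def Y : Poly := MvPolynomial.X (Sum.inr 1)

/-- The action of `g ∈ GL(V)` on `ℂ[V × V*]` by algebra automorphisms: on the span of `x, y` it is
the natural action on `V`, and on the span of `X, Y` it is the contragredient action on `V*`. -/
def act (g : GL (Fin 2) ℂ) : Poly →ₐ[ℂ] Poly :=
  aeval (Sum.elim
    (fun j => ∑ i, C (g.val i j) * MvPolynomial.X (Sum.inl i))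
    (fun j => ∑ i, C ((g⁻¹).val j i) * MvPolynomial.X (Sum.inr i)))

/-- As a function on `V × V*`, the polynomial `act g f` is `(v, ξ) ↦ f (g⁻¹ v, g⁻¹ ξ)`, where
`g⁻¹ ξ = ξ ∘ g` has coordinates `ξ ᵥ* g`. -/
theorem eval_act (g : GL (Fin 2) ℂ) (f : Poly) (v ξ : Fin 2 → ℂ) :
    eval (Sum.elim ξ v) (act g f) =
      eval (Sum.elim (Matrix.vecMul ξ g.val) (Matrix.mulVec (g⁻¹).val v)) f := by
  have h : (aeval (R := ℂ) (Sum.elim ξ v)).comp (act g) =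
      aeval (Sum.elim (Matrix.vecMul ξ g.val) (Matrix.mulVec (g⁻¹).val v)) := by
    refine MvPolynomial.algHom_ext ?_
    rintro (j | j)
    · simp [act, Matrix.vecMul, dotProduct, mul_comm]
    · fin_cases j <;> simp [act]
  simpa [aeval_eq_eval] using DFunLike.congr_fun h f

/-- The invariant algebra `ℂ[V × V*]^G` of a subgroup `G` of `GL(V)`. -/
def invariants (G : Subgroup (GL (Fin 2) ℂ)) : Subalgebra ℂ Poly :=
  ⨅ g ∈ G, AlgHom.equalizer (act g) (AlgHom.id ℂ Poly)

theorem mem_invariants (G : Subgroup (GL (Fin 2) ℂ)) (f : Poly) :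
    f ∈ invariants G ↔ ∀ g ∈ G, act g f = f := by
  simp [invariants, Algebra.mem_iInf, AlgHom.mem_equalizer]

def q : Poly := x * y
def Q : Poly := X * Y
def eu : Poly := x * X + y * Y

/-- The element `a_{i,0}` of `ℂ[V × V*]`, for `0 ≤ i ≤ d`. -/
def a (d i : ℕ) : Poly := x ^ (d - i) * Y ^ i + y ^ (d - i) * X ^ i

/-- The polynomials `Ψ_i (T, T', T'')`, where `T, T', T''` are the variables `0, 1, 2`. -/
def Psi : ℕ → MvPolynomial (Fin 3) ℂ
  | 0 => 1
  | 1 => MvPolynomial.X 0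
  | n + 2 => MvPolynomial.X 0 * Psi (n + 1) - MvPolynomial.X 1 * MvPolynomial.X 2 * Psi n

/-- The identity that characterizes `Ψ_i`. -/
theorem aeval_Psi (i : ℕ) :
    aeval ![eu, q, Q] (Psi i) * (x * X - y * Y) = (x * X) ^ (i + 1) - (y * Y) ^ (i + 1) := by
  induction i using Nat.twoStepInduction with
  | zero => simp [Psi]
  | one => simp [Psi, eu]; ring
  | more n h0 h1 =>
    have h : aeval ![eu, q, Q] (Psi (n + 2)) * (x * X - y * Y)
        = eu * (aeval ![eu, q, Q] (Psi (n + 1)) * (x * X - y * Y))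
          - q * Q * (aeval ![eu, q, Q] (Psi n) * (x * X - y * Y)) := by
      simp [Psi]; ring
    rw [h, h0, h1, eu, q, Q]
    ring

/-- `Ψ_i` is the only polynomial with that property. -/
theorem eq_Psi (i : ℕ) (P : MvPolynomial (Fin 3) ℂ)
    (hP : aeval ![eu, q, Q] P * (x * X - y * Y) = (x * X) ^ (i + 1) - (y * Y) ^ (i + 1)) :
    P = Psi i := by
  have hne : x * X - y * Y ≠ 0 := by
    intro h
    have h1 := congrArg (eval (Sum.elim ![1, 0] ![1, 0] : Fin 2 ⊕ Fin 2 → ℂ)) h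
    simp [x, y, X, Y] at h1
  have h0 : aeval ![eu, q, Q] (P - Psi i) = 0 := by
    rw [map_sub, sub_eq_zero]
    exact mul_right_cancel₀ hne (hP.trans (aeval_Psi i).symm)
  have key : (P - Psi i) * (MvPolynomial.X 1 * MvPolynomial.X 2) = 0 := by
    refine MvPolynomial.funext fun w => ?_
    simp only [map_mul, eval_X, map_zero]
    by_cases h1 : w 1 = 0
    · simp [h1]
    by_cases h2 : w 2 = 0
    · simp [h2]
    obtain ⟨r, hr⟩ := IsAlgClosed.exists_pow_nat_eq (discrim (w 1) (-w 0) (w 2)) (n := 2) (by simp)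
    obtain ⟨u, hu⟩ := exists_quadratic_eq_zero h1 ⟨r, by rw [← hr]; ring⟩
    have hu0 : u ≠ 0 := by
      rintro rfl
      simp [h2] at hu
    have h3 : (aeval (R := ℂ) (Sum.elim ![w 1, 1] ![u, w 2 / u])).comp (aeval ![eu, q, Q])
        = aeval w := by
      refine MvPolynomial.algHom_ext fun k => ?_
      fin_cases k
      · simp [eu, x, y, X, Y]
        field_simp
        linear_combination hu
      · simp [q, x, y]
      · simp [Q, X, Y]
        field_simp
    have h4 := DFunLike.congr_fun h3 (P - Psi i)
    rw [AlgHom.comp_apply, h0, map_zero] at h4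
    rw [← aeval_eq_eval w]
    exact mul_eq_zero_of_left h4.symm _
  have hX : (MvPolynomial.X 1 * MvPolynomial.X 2 : MvPolynomial (Fin 3) ℂ) ≠ 0 :=
    mul_ne_zero (X_ne_zero _) (X_ne_zero _)
  exact sub_eq_zero.mp ((mul_eq_zero.mp key).resolve_right hX)

/-- The symbols `q, Q, eu_0, a_{0,0}, …, a_{d,0}` of the presentation. -/
inductive Gen (d : ℕ) : Type
  | q : Gen d
  | Q : Gen d
  | eu : Gen d
  | a (i : Fin (d + 1)) : Gen d

/-- The element of `ℂ[V × V*]` that a symbol stands for. -/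
def Gen.toPoly {d : ℕ} : Gen d → Poly
  | .q => DihedralInvariants.q
  | .Q => DihedralInvariants.Q
  | .eu => DihedralInvariants.eu
  | .a i => DihedralInvariants.a d i

/-- The relations `eu_0 a_{i,0} = q a_{i+1,0} + Q a_{i-1,0}` for `1 ≤ i ≤ d - 1`, written as
elements (left-hand side minus right-hand side) of the free commutative algebra. -/
def relLinear (d : ℕ) : Set (MvPolynomial (Gen d) ℂ) :=
  {r | ∃ (i : ℕ) (_ : 1 ≤ i) (_ : i ≤ d - 1),
    r = .X .eu * .X (.a ⟨i, by omega⟩)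
      - (.X .q * .X (.a ⟨i + 1, by omega⟩) + .X .Q * .X (.a ⟨i - 1, by omega⟩))}

/-- The relations `a_{i-1,0} a_{j+1,0} - a_{i,0} a_{j,0} =
(eu_0 ^ 2 - 4 q Q) q ^ (d-j-1) Q ^ (i-1) Ψ_{j-i} (eu_0, q, Q)` for `1 ≤ i ≤ j ≤ d - 1`. -/
def relQuadratic (d : ℕ) : Set (MvPolynomial (Gen d) ℂ) :=
  {r | ∃ (i j : ℕ) (_ : 1 ≤ i) (_ : i ≤ j) (_ : j ≤ d - 1),
    r = (.X (.a ⟨i - 1, by omega⟩) * .X (.a ⟨j + 1, by omega⟩)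
        - .X (.a ⟨i, by omega⟩) * .X (.a ⟨j, by omega⟩))
      - (.X .eu ^ 2 - 4 * .X .q * .X .Q) * .X .q ^ (d - j - 1) * .X .Q ^ (i - 1)
        * aeval ![.X .eu, .X .q, .X .Q] (Psi (j - i))}

end

end DihedralInvariants

/-!
Averaging a monomial over `s_0` gives `x^i y^j X^k Y^l + y^i x^j Y^k X^l`, and invariance under
`s_1 s_0` forces `i + l ≡ j + k` modulo `d`; such symmetrized monomials reduce to the generators by
splitting off factors `q`, `Q`, `eu_0` and `a_{i,0}`.

For the kernel, let `P = ℂ[q, Q, a_0, a_d]`. The relations show that the presented algebra is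
spanned over `P` by the `2 d` elements `1, eu, …, eu^d, a_1, …, a_{d-1}`. On the other hand the
values of `q, Q, a_0, a_d` are algebraically independent and are fixed by the dihedral group acting
on the variables `x, y` alone, under which `eu` has `2 d` distinct conjugates. By the Vandermonde
determinant `1, eu, …, eu^(2d-1)` are therefore independent over `P`, so the presented algebra has
no room for a kernel.
-/

namespace DihedralInvariants

open MvPolynomial

section General

theorem injective_of_span_eq_top_of_linearIndependent {R M N ι κ : Type*} [CommRing R]
    [AddCommGroup M] [Module R M] [AddCommGroup N] [Module R N] [Fintype ι] [Fintype κ]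
    {b : ι → M} (hb : Submodule.span R (Set.range b) = ⊤) (π : M →ₗ[R] N) {v : κ → M}
    (hv : LinearIndependent R (π ∘ v)) (hcard : Fintype.card ι ≤ Fintype.card κ) :
    Function.Injective π := by
  obtain ⟨φ⟩ := Function.Embedding.nonempty_of_card_le hcard
  have hsurj : Function.Surjective (Finsupp.linearCombination R b) := by
    rw [← LinearMap.range_eq_top, Finsupp.range_linearCombination, hb]
  have hindep : LinearIndependent R (π.rangeRestrict ∘ v ∘ φ) :=
    .of_comp π.range.subtype (hv.comp φ φ.injective)
  have hrange : Function.Surjective (π.rangeRestrict ∘ₗ Finsupp.linearCombination R b) :=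
    π.surjective_rangeRestrict.comp hsurj
  have : Module.Finite R π.range := .of_surjective _ hrange
  have hinj := OrzechProperty.injective_of_surjective_of_injective _ _ hindep hrange
  have hcomp : Function.Injective (π ∘ Finsupp.linearCombination R b) :=
    Subtype.val_injective.comp hinj
  exact hcomp.of_comp_right hsurj

theorem linearIndependent_pow_of_injective_conjugates {P A ι : Type*} [CommRing P] [CommRing A]
    [IsDomain A] [Algebra P A] [FaithfulSMul P A] [Fintype ι] {e : A} (σ : ι → A →ₐ[P] A)
    (hσ : Function.Injective fun i => σ i e) :
    LinearIndependent P fun k : Fin (Fintype.card ι) => e ^ (k : ℕ) := by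
  refine Fintype.linearIndependent_iff.2 fun c hc k => ?_
  have hconj (i : ι) : ∑ k, algebraMap P A (c k) * σ i e ^ (k : ℕ) = 0 := by
    simpa [Algebra.smul_def] using congrArg (σ i) hc
  have hzero := Matrix.eq_zero_of_forall_index_sum_mul_pow_eq_zero
    (hσ.comp (Fintype.equivFin ι).symm.injective) fun j => hconj _
  exact FaithfulSMul.algebraMap_injective P A ((congrFun hzero k).trans (map_zero _).symm)

theorem algebraicIndependent_of_forall_exists_eval_eq {K σ ι : Type*} [CommRing K] [IsDomain K]
    [Infinite K] {f : ι → MvPolynomial σ K}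
    (hf : ∀ w : ι → K, ∃ p : σ → K, ∀ i, eval p (f i) = w i) :
    AlgebraicIndependent K f := by
  refine algebraicIndependent_iff.2 fun F hF => MvPolynomial.funext fun w => ?_
  obtain ⟨p, hp⟩ := hf w
  have heval : (aeval p).comp (aeval f) = (aeval w : MvPolynomial ι K →ₐ[K] K) :=
    MvPolynomial.algHom_ext fun i => by simp [aeval_eq_eval, hp]
  have hFw := DFunLike.congr_fun heval F
  rw [AlgHom.comp_apply, hF, map_zero, aeval_eq_eval] at hFw
  rw [map_zero]
  exact hFw.symm

theorem span_eq_top_of_forall_mul_mem {k P B : Type*} [CommSemiring k] [CommSemiring P]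
    [Semiring B] [Algebra k P] [Algebra k B] [Algebra P B] [IsScalarTower k P B]
    {S G : Set B} (hS : Algebra.adjoin k S = ⊤) (hone : 1 ∈ Submodule.span P G)
    (hmul : ∀ s ∈ S, ∀ z ∈ G, s * z ∈ Submodule.span P G) : Submodule.span P G = ⊤ := by
  have hclosed (b : B) (hb : b ∈ Algebra.adjoin k S) :
      ∀ z ∈ Submodule.span P G, b * z ∈ Submodule.span P G := by
    induction hb using Algebra.adjoin_induction with
    | mem s hs =>
      intro z hz
      have hle : Submodule.span P G ≤ (Submodule.span P G).comap (LinearMap.mulLeft P s) :=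
        Submodule.span_le.2 (hmul s hs)
      exact hle hz
    | algebraMap r =>
      intro z hz
      rw [← Algebra.smul_def]
      exact Submodule.smul_of_tower_mem _ r hz
    | add b c _ _ hb hc => intro z hz; rw [add_mul]; exact add_mem (hb z hz) (hc z hz)
    | mul b c _ _ hb hc => intro z hz; rw [mul_assoc]; exact hb _ (hc z hz)
  refine Submodule.eq_top_iff'.2 fun b => ?_
  simpa using hclosed b (hS ▸ Algebra.mem_top) 1 hone

theorem adjoin_range_quotient_mk_X {R σ : Type*} [CommRing R] (I : Ideal (MvPolynomial σ R)) :
    Algebra.adjoin R (Set.range fun i => Ideal.Quotient.mk I (MvPolynomial.X i)) = ⊤ := by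
  change Algebra.adjoin R (Set.range fun i => Ideal.Quotient.mkₐ R I (MvPolynomial.X i)) = ⊤
  rw [Set.range_comp' (Ideal.Quotient.mkₐ R I), ← AlgHom.map_adjoin, adjoin_range_X,
    Algebra.map_top, AlgHom.range_eq_top]
  exact Ideal.Quotient.mk_surjective

theorem coeff_aeval_C_mul_X {R σ : Type*} [CommSemiring R] (c : σ → R) (f : MvPolynomial σ R)
    (m : σ →₀ ℕ) :
    coeff m (aeval (fun i => C (c i) * MvPolynomial.X i) f)
      = (m.prod fun i k => c i ^ k) * coeff m f := by
  classical
  induction f using MvPolynomial.induction_on' with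
  | monomial u r =>
    have hprod : (u.prod fun i k => (C (c i) * MvPolynomial.X i : MvPolynomial σ R) ^ k)
        = C (u.prod fun i k => c i ^ k) * monomial u 1 := by
      simp [mul_pow, Finsupp.prod_mul, monomial_eq, map_finsuppProd]
    rw [aeval_monomial, hprod, algebraMap_eq, C_mul_monomial, C_mul_monomial, coeff_monomial,
      coeff_monomial]
    split_ifs with h
    · rw [h, mul_one, mul_comm]
    · rw [mul_zero]
  | add f g hf hg => rw [map_add, coeff_add, coeff_add, hf, hg, mul_add]

theorem mul_mem_of_mem_bot {P B : Type*} [CommSemiring P] [Semiring B] [Algebra P B]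
    {M : Submodule P B} {c z : B} (hc : c ∈ (⊥ : Subalgebra P B)) (hz : z ∈ M) : c * z ∈ M := by
  obtain ⟨r, rfl⟩ := Algebra.mem_bot.1 hc
  rw [← Algebra.smul_def]
  exact M.smul_mem r hz

section Powers

variable {P B : Type*} [CommRing P] [CommRing B] [Algebra P B] {M : Submodule P B} {e : B}
  {n : ℕ} {F : Polynomial P}

theorem aeval_mem_of_natDegree_lt (hM : ∀ j < n, e ^ j ∈ M) (hF : F.natDegree < n) :
    Polynomial.aeval e F ∈ M := by
  rw [Polynomial.aeval_eq_sum_range' hF]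
  exact sum_mem fun j hj => M.smul_mem _ (hM j (Finset.mem_range.1 hj))

theorem pow_mem_of_aeval_mem (hM : ∀ j < n, e ^ j ∈ M) (hn : n ≠ 0)
    (hF : F.IsMonicOfDegree n) (haeval : Polynomial.aeval e F ∈ M) : e ^ n ∈ M := by
  have hlower := aeval_mem_of_natDegree_lt hM (hF.natDegree_sub_X_pow hn)
  have hsub := sub_mem haeval hlower
  rwa [map_sub, map_pow, Polynomial.aeval_X, sub_sub_cancel] at hsub

end Powers

end General

section Action

theorem act_mul (g h : GL (Fin 2) ℂ) : act (g * h) = (act g).comp (act h) := by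
  refine MvPolynomial.algHom_ext ?_
  rintro (j | j)
  · simp [act, Matrix.mul_apply, Fin.sum_univ_two]
    ring
  · simp [act, Matrix.mul_apply, Fin.sum_univ_two, mul_inv_rev, -Matrix.coe_units_inv]
    ring

theorem act_one : act 1 = AlgHom.id ℂ Poly := by
  refine MvPolynomial.algHom_ext ?_
  rintro (j | j) <;> fin_cases j <;> simp [act, Fin.sum_univ_two]

theorem mem_invariants_closure_iff (S : Set (GL (Fin 2) ℂ)) (f : Poly) :
    f ∈ invariants (Subgroup.closure S) ↔ ∀ g ∈ S, act g f = f := by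
  rw [mem_invariants]
  refine ⟨fun h g hg => h g (Subgroup.subset_closure hg), fun h g hg => ?_⟩
  induction hg using Subgroup.closure_induction with
  | mem g hg => exact h g hg
  | one => rw [act_one, AlgHom.id_apply]
  | mul g k _ _ hg hk => rw [act_mul, AlgHom.comp_apply, hk, hg]
  | inv g _ hg =>
    conv_lhs => rw [← hg]
    rw [← AlgHom.comp_apply, ← act_mul, inv_mul_cancel, act_one, AlgHom.id_apply]

variable {ζ : ℂˣ}

theorem mem_invariants_W_iff {f : Poly} :
    f ∈ invariants (W ζ) ↔ act (s ζ 0) f = f ∧ act (s ζ 1) f = f := by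
  simp [W, mem_invariants_closure_iff]

theorem s_inv (i : ℤ) : (s ζ i)⁻¹ = s ζ i := rfl

theorem act_s_x (i : ℤ) : act (s ζ i) x = C ((ζ ^ (-i) : ℂˣ) : ℂ) * y := by
  simp only [act, x, y, aeval_X, Sum.elim_inl, Fin.sum_univ_two]
  simp [s]

theorem act_s_y (i : ℤ) : act (s ζ i) y = C ((ζ ^ i : ℂˣ) : ℂ) * x := by
  simp only [act, x, y, aeval_X, Sum.elim_inl, Fin.sum_univ_two]
  simp [s]

theorem act_s_X (i : ℤ) : act (s ζ i) X = C ((ζ ^ i : ℂˣ) : ℂ) * Y := by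
  simp only [act, X, Y, aeval_X, Sum.elim_inr, Fin.sum_univ_two, s_inv]
  simp [s]

theorem act_s_Y (i : ℤ) : act (s ζ i) Y = C ((ζ ^ (-i) : ℂˣ) : ℂ) * X := by
  simp only [act, X, Y, aeval_X, Sum.elim_inr, Fin.sum_univ_two, s_inv]
  simp [s]

theorem C_unit_pow_mul_C_unit_pow {R σ : Type*} [CommSemiring R] {u v : Rˣ} {m n : ℕ}
    (h : u ^ m * v ^ n = 1) :
    (C (u : R) : MvPolynomial σ R) ^ m * C (v : R) ^ n = 1 := by
  rw [← C_pow, ← C_pow, ← C_mul]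
  exact_mod_cast congrArg (fun w : Rˣ => (C (w : R) : MvPolynomial σ R)) h

theorem act_s_toPoly {d : ℕ} (hζ : ζ ^ d = 1) (i : ℤ) (g : Gen d) :
    act (s ζ i) g.toPoly = g.toPoly := by
  have hinv : (C ((ζ ^ (-i) : ℂˣ) : ℂ) * C ((ζ ^ i : ℂˣ) : ℂ) : Poly) = 1 := by
    simpa using C_unit_pow_mul_C_unit_pow (σ := Fin 2 ⊕ Fin 2) (u := ζ ^ (-i)) (v := ζ ^ i)
      (m := 1) (n := 1) (by simp)
  cases g with
  | q =>
    simp only [Gen.toPoly, q, map_mul, act_s_x, act_s_y]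
    linear_combination x * y * hinv
  | Q =>
    simp only [Gen.toPoly, Q, map_mul, act_s_X, act_s_Y]
    linear_combination X * Y * hinv
  | eu =>
    simp only [Gen.toPoly, eu, map_mul, map_add, act_s_x, act_s_y, act_s_X, act_s_Y]
    linear_combination (x * X + y * Y) * hinv
  | a k =>
    have hroot (j : ℤ) : (C ((ζ ^ j : ℂˣ) : ℂ) : Poly) ^ (d - k : ℕ)
        * C ((ζ ^ j : ℂˣ) : ℂ) ^ (k : ℕ) = 1 := by
      refine C_unit_pow_mul_C_unit_pow ?_
      rw [← pow_add, Nat.sub_add_cancel k.is_le, ← zpow_natCast, zpow_comm, zpow_natCast, hζ,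
        one_zpow]
    simp only [Gen.toPoly, a, map_mul, map_add, map_pow, act_s_x, act_s_y, act_s_X, act_s_Y,
      mul_pow]
    linear_combination y ^ (d - k : ℕ) * X ^ (k : ℕ) * hroot (-i)
      + x ^ (d - k : ℕ) * Y ^ (k : ℕ) * hroot i

theorem range_le_invariants {d : ℕ} (hζ : ζ ^ d = 1) :
    (aeval (R := ℂ) (Gen.toPoly (d := d))).range ≤ invariants (W ζ) := by
  rw [← Algebra.adjoin_range_eq_range_aeval, Algebra.adjoin_le_iff]
  rintro _ ⟨g, rfl⟩
  exact mem_invariants_W_iff.2 ⟨act_s_toPoly hζ 0 g, act_s_toPoly hζ 1 g⟩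

end Action

section SymmetrizedMonomials

/-- The sum of the monomial `x ^ i * y ^ j * X ^ k * Y ^ l` and its image under `s ζ 0`. -/
noncomputable def symMonomial (i j k l : ℕ) : Poly :=
  x ^ i * y ^ j * X ^ k * Y ^ l + y ^ i * x ^ j * Y ^ k * X ^ l

theorem symMonomial_swap (i j k l : ℕ) : symMonomial j i l k = symMonomial i j k l := by
  simp only [symMonomial]
  ring

theorem symMonomial_zero : symMonomial 0 0 0 0 = 2 := by
  norm_num [symMonomial]

theorem symMonomial_one_zero_one_zero : symMonomial 1 0 1 0 = eu := by
  simp [symMonomial, eu]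

theorem symMonomial_sub_zero_zero (d m : ℕ) : symMonomial (d - m) 0 0 m = a d m := by
  simp [symMonomial, a]

theorem q_mul_symMonomial (i j k l : ℕ) :
    q * symMonomial i j k l = symMonomial (i + 1) (j + 1) k l := by
  simp only [symMonomial, q]
  ring

theorem Q_mul_symMonomial (i j k l : ℕ) :
    Q * symMonomial i j k l = symMonomial i j (k + 1) (l + 1) := by
  simp only [symMonomial, Q]
  ring

theorem eu_mul_symMonomial (i j k l : ℕ) :
    eu * symMonomial i j k l
      = symMonomial (i + 1) j (k + 1) l + symMonomial i (j + 1) k (l + 1) := by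
  simp only [symMonomial, eu]
  ring

theorem a_mul_symMonomial (d m i j k l : ℕ) :
    a d m * symMonomial i j k l
      = symMonomial (i + (d - m)) j k (l + m) + symMonomial i (j + (d - m)) (k + m) l := by
  simp only [symMonomial, a]
  ring

variable {d : ℕ} {A : Subalgebra ℂ Poly}

/-- The subalgebra `A` contains the symmetrized monomials of degree less than `n` whose weight
vanishes modulo `d`, where `x, Y` have weight `1` and `y, X` have weight `-1`. -/
def ContainsSymMonomialsBelow (A : Subalgebra ℂ Poly) (d n : ℕ) : Prop :=
  ∀ i j k l : ℕ, i + j + k + l < n → (i + l : ZMod d) = j + k → symMonomial i j k l ∈ A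

theorem symMonomial_succ_zero_succ_zero_mem (hq : q ∈ A) (hQ : Q ∈ A) (heu : eu ∈ A) {i k : ℕ}
    (hA : ContainsSymMonomialsBelow A d (i + k + 2)) (hw : (i : ZMod d) = k) :
    symMonomial (i + 1) 0 (k + 1) 0 ∈ A := by
  match i, k with
  | 0, 0 => rwa [symMonomial_one_zero_one_zero]
  | 0, k + 1 =>
    rw [eq_sub_of_add_eq (eu_mul_symMonomial 0 0 (k + 1) 0).symm, ← Q_mul_symMonomial]
    push_cast at hw
    refine sub_mem (mul_mem heu (hA _ _ _ _ (by lia) ?_)) (mul_mem hQ (hA _ _ _ _ (by lia) ?_))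
    · push_cast
      linear_combination hw
    · push_cast
      linear_combination hw
  | i + 1, k =>
    rw [eq_sub_of_add_eq (eu_mul_symMonomial (i + 1) 0 k 0).symm, ← q_mul_symMonomial]
    push_cast at hw
    refine sub_mem (mul_mem heu (hA _ _ _ _ (by lia) ?_)) (mul_mem hq (hA _ _ _ _ (by lia) ?_))
    · push_cast
      linear_combination hw
    · push_cast
      linear_combination hw

theorem symMonomial_mem_of_pos (hq : q ∈ A) (hQ : Q ∈ A) (heu : eu ∈ A) {i j k l : ℕ}
    (hA : ContainsSymMonomialsBelow A d (i + j + k + l)) (hw : (i + l : ZMod d) = j + k)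
    (hil : 0 < i + l) (hjk : 0 < j + k) : symMonomial i j k l ∈ A := by
  match i, j, k, l with
  | i + 1, j + 1, k, l =>
    rw [← q_mul_symMonomial]
    push_cast at hw
    exact mul_mem hq (hA _ _ _ _ (by lia) (by linear_combination hw))
  | i, j, k + 1, l + 1 =>
    rw [← Q_mul_symMonomial]
    push_cast at hw
    exact mul_mem hQ (hA _ _ _ _ (by lia) (by linear_combination hw))
  | i + 1, 0, k + 1, 0 =>
    push_cast at hw
    refine symMonomial_succ_zero_succ_zero_mem (d := d) hq hQ heu ?_ (by linear_combination hw)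
    convert hA using 1
    ring
  | 0, j + 1, 0, l + 1 =>
    rw [symMonomial_swap]
    push_cast at hw
    refine symMonomial_succ_zero_succ_zero_mem (d := d) hq hQ heu ?_ (by linear_combination -hw)
    convert hA using 1
    ring

theorem symMonomial_zero_zero_mem (hgen : ∀ g : Gen d, g.toPoly ∈ A) {i l : ℕ}
    (hA : ContainsSymMonomialsBelow A d (i + l)) (hw : (i + l : ZMod d) = 0) :
    symMonomial i 0 0 l ∈ A := by
  have hdvd : d ∣ i + l := (ZMod.natCast_eq_zero_iff _ _).1 (by exact_mod_cast hw)
  rcases (i + l).eq_zero_or_pos with hzero | hpos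
  · obtain ⟨rfl, rfl⟩ := Nat.add_eq_zero_iff.1 hzero
    exact symMonomial_zero ▸ ofNat_mem A 2
  have hd := Nat.pos_of_dvd_of_pos hdvd hpos
  have hle := Nat.le_of_dvd hpos hdvd
  obtain ⟨m, i', l', hm, rfl, rfl⟩ : ∃ m i' l', m ≤ d ∧ i = i' + (d - m) ∧ l = l' + m :=
    ⟨min l d, i - (d - min l d), l - min l d, by lia, by lia, by lia⟩
  have ha : a d m ∈ A := hgen (.a ⟨m, Nat.lt_succ_of_le hm⟩)
  have hw' : (i' + l' : ZMod d) = 0 := by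
    push_cast [hm] at hw
    linear_combination hw - CharP.cast_eq_zero (ZMod d) d
  rcases (i' + l').eq_zero_or_pos with hzero | hpos
  · obtain ⟨rfl, rfl⟩ := Nat.add_eq_zero_iff.1 hzero
    rwa [zero_add, zero_add, symMonomial_sub_zero_zero]
  rw [eq_sub_of_add_eq (a_mul_symMonomial d m i' 0 0 l').symm, zero_add, zero_add]
  refine sub_mem (mul_mem ha (hA _ _ _ _ (by lia) (by simpa using hw'))) ?_
  refine symMonomial_mem_of_pos (d := d) (hgen .q) (hgen .Q) (hgen .eu) ?_ ?_ hpos (by lia)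
  · convert hA using 1
    ring
  · push_cast [hm]
    linear_combination hw' - CharP.cast_eq_zero (ZMod d) d

theorem symMonomial_mem (hgen : ∀ g : Gen d, g.toPoly ∈ A) {i j k l : ℕ}
    (hw : (i + l : ZMod d) = j + k) : symMonomial i j k l ∈ A := by
  induction hn : i + j + k + l using Nat.strong_induction_on generalizing i j k l with
  | _ n ih =>
    subst hn
    have hA : ContainsSymMonomialsBelow A d (i + j + k + l) :=
      fun i j k l hlt hw => ih _ hlt hw rfl
    rcases (i + l).eq_zero_or_pos with hil | hil
    · obtain ⟨rfl, rfl⟩ := Nat.add_eq_zero_iff.1 hil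
      rw [symMonomial_swap]
      refine symMonomial_zero_zero_mem hgen ?_ (by simpa using hw.symm)
      simpa using hA
    rcases (j + k).eq_zero_or_pos with hjk | hjk
    · obtain ⟨rfl, rfl⟩ := Nat.add_eq_zero_iff.1 hjk
      exact symMonomial_zero_zero_mem hgen hA (by simpa using hw)
    · exact symMonomial_mem_of_pos (hgen .q) (hgen .Q) (hgen .eu) hA hw hil hjk

end SymmetrizedMonomials

section Invariants

variable {ζ : ℂˣ} {f : Poly}

theorem monomial_eq_C_mul_xyXY (m : Fin 2 ⊕ Fin 2 →₀ ℕ) (r : ℂ) :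
    (monomial m r : Poly) = C r * (x ^ m (.inl 0) * y ^ m (.inl 1) * X ^ m (.inr 0)
      * Y ^ m (.inr 1)) := by
  rw [monomial_eq, Finsupp.prod_fintype _ _ (by simp)]
  simp only [Fintype.prod_sum_type, Fin.prod_univ_two, x, y, X, Y]
  ring

theorem act_s_one_comp_act_s_zero :
    (act (s ζ 1)).comp (act (s ζ 0)) = aeval fun i => C (Sum.elim ![(ζ : ℂ), (ζ : ℂ)⁻¹]
      ![(ζ : ℂ)⁻¹, (ζ : ℂ)] i) * MvPolynomial.X i := by
  have hx := act_s_x (ζ := ζ)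
  have hy := act_s_y (ζ := ζ)
  have hX := act_s_X (ζ := ζ)
  have hY := act_s_Y (ζ := ζ)
  simp only [x, y, X, Y] at hx hy hX hY
  refine MvPolynomial.algHom_ext ?_
  rintro (j | j) <;> fin_cases j <;> simp [hx, hy, hX, hY]

theorem weight_eq_zero_of_mem_support {d : ℕ} (hζ : IsPrimitiveRoot ζ d)
    (hf : f ∈ invariants (W ζ)) {m : Fin 2 ⊕ Fin 2 →₀ ℕ} (hm : m ∈ f.support) :
    (m (.inl 0) + m (.inr 1) : ZMod d) = m (.inl 1) + m (.inr 0) := by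
  obtain ⟨h0, h1⟩ := mem_invariants_W_iff.1 hf
  have hrot : aeval (fun i => C (Sum.elim ![(ζ : ℂ), (ζ : ℂ)⁻¹] ![(ζ : ℂ)⁻¹, (ζ : ℂ)] i)
      * MvPolynomial.X i) f = f := by
    rw [← act_s_one_comp_act_s_zero, AlgHom.comp_apply, h0, h1]
  have hcoeff := congrArg (coeff m) hrot
  rw [coeff_aeval_C_mul_X, mul_eq_right₀ (mem_support_iff.1 hm),
    Finsupp.prod_fintype _ _ (by simp)] at hcoeff
  have hpow : ζ ^ ((m (.inl 0) + m (.inr 1) : ℕ) - (m (.inl 1) + m (.inr 0) : ℕ) : ℤ) = 1 := by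
    rw [zpow_sub, zpow_natCast, zpow_natCast, ← Units.val_inj, Units.val_one, ← hcoeff]
    simp [Fintype.prod_sum_type, pow_add]
    ring
  rw [hζ.zpow_eq_one_iff_dvd, ← ZMod.intCast_zmod_eq_zero_iff_dvd] at hpow
  push_cast at hpow
  exact sub_eq_zero.1 hpow

theorem add_act_s_zero (f : Poly) :
    f + act (s ζ 0) f = ∑ m ∈ f.support, C (coeff m f)
      * symMonomial (m (.inl 0)) (m (.inl 1)) (m (.inr 0)) (m (.inr 1)) := by
  conv_lhs => rw [f.as_sum]
  rw [map_sum, ← Finset.sum_add_distrib]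
  refine Finset.sum_congr rfl fun m _ => ?_
  have hC (r : ℂ) : act (s ζ 0) (C r) = C r := (act (s ζ 0)).commutes r
  simp only [monomial_eq_C_mul_xyXY, map_mul, map_pow, hC, act_s_x, act_s_y, act_s_X, act_s_Y,
    neg_zero, zpow_zero, Units.val_one, C_1, one_mul, symMonomial]
  ring

theorem invariants_le_range {d : ℕ} (hζ : IsPrimitiveRoot ζ d) :
    invariants (W ζ) ≤ (aeval (R := ℂ) (Gen.toPoly (d := d))).range := by
  intro f hf
  have hsum : f + f ∈ (aeval (R := ℂ) (Gen.toPoly (d := d))).range := by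
    conv => enter [2, 2]; rw [← (mem_invariants_W_iff.1 hf).1]
    rw [add_act_s_zero]
    refine sum_mem fun m hm => mul_mem (Subalgebra.algebraMap_mem _ _) ?_
    refine symMonomial_mem (fun g => ?_) (weight_eq_zero_of_mem_support hζ hf hm)
    exact ⟨MvPolynomial.X g, aeval_X _ g⟩
  have hhalf : f = (1 / 2 : ℂ) • (f + f) := by
    rw [← two_smul ℂ f, smul_smul]
    norm_num
  rw [hhalf]
  exact Subalgebra.smul_mem _ hsum _

theorem range_eq_invariants {d : ℕ} (hζ : IsPrimitiveRoot ζ d) :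
    (aeval (R := ℂ) (Gen.toPoly (d := d))).range = invariants (W ζ) :=
  (range_le_invariants hζ.pow_eq_one).antisymm (invariants_le_range hζ)

end Invariants

section Relations

variable {B : Type*} [CommRing B] [Algebra ℂ B]

/-- The elements `q, Q, e, a 0, …, a d` of `B` satisfy the relations of the presentation. The
indices are shifted with respect to `relLinear` and `relQuadratic` so that no subtraction occurs:
`quadratic i m n` is the relation with indices `i + 1` and `i + m + 1`, where
`d = i + m + n + 2`. -/
structure DihedralRelations (d : ℕ) (q Q e : B) (a : ℕ → B) : Prop where
  linear : ∀ i, i + 2 ≤ d → e * a (i + 1) = q * a (i + 2) + Q * a i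
  quadratic : ∀ i m n, i + m + n + 2 = d → a i * a (i + m + 2) - a (i + 1) * a (i + m + 1)
    = (e ^ 2 - 4 * q * Q) * q ^ n * Q ^ i * aeval ![e, q, Q] (Psi m)

theorem dihedralRelations_poly (d : ℕ) : DihedralRelations d q Q eu (a d) where
  linear i hi := by
    obtain ⟨n, rfl⟩ := Nat.exists_eq_add_of_le' hi
    have h0 : n + (i + 2) - i = n + 2 := by lia
    have h1 : n + (i + 2) - (i + 1) = n + 1 := by lia
    simp only [eu, q, Q, a, h0, h1, Nat.add_sub_cancel]
    ring
  quadratic i m n hd := by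
    subst hd
    have h0 : i + m + n + 2 - i = n + m + 2 := by lia
    have h1 : i + m + n + 2 - (i + 1) = n + m + 1 := by lia
    have h2 : i + m + n + 2 - (i + m + 1) = n + 1 := by lia
    have h3 : i + m + n + 2 - (i + m + 2) = n := by lia
    have hPsi : (eu ^ 2 - 4 * q * Q) * aeval ![eu, q, Q] (Psi m)
        = (x * X - y * Y) * ((x * X) ^ (m + 1) - (y * Y) ^ (m + 1)) := by
      rw [← aeval_Psi, eu, q, Q]
      ring
    rw [mul_right_comm, mul_right_comm _ (q ^ n), hPsi]
    simp only [a, h0, h1, h2, h3, q, Q]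
    ring

variable {d : ℕ} {f : MvPolynomial (Gen d) ℂ →ₐ[ℂ] B} {a : ℕ → B}

theorem map_aeval_Psi (m : ℕ) :
    f (aeval ![.X .eu, .X .q, .X .Q] (Psi m))
      = aeval ![f (.X .eu), f (.X .q), f (.X .Q)] (Psi m) := by
  rw [← AlgHom.comp_apply, comp_aeval]
  congr 2
  ext i
  fin_cases i <;> rfl

theorem map_relLinear_eq_zero_iff (ha : ∀ i : Fin (d + 1), f (.X (.a i)) = a i) :
    (∀ r ∈ relLinear d, f r = 0) ↔
      ∀ i, i + 2 ≤ d → f (.X .eu) * a (i + 1) = f (.X .q) * a (i + 2) + f (.X .Q) * a i := by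
  constructor
  · intro h i hi
    simpa [sub_eq_zero, ha] using h _ ⟨i + 1, by lia, by lia, rfl⟩
  · rintro h _ ⟨i, h1, hi, rfl⟩
    obtain ⟨i, rfl⟩ := Nat.exists_eq_add_of_le' h1
    simpa [sub_eq_zero, ha] using h i (by lia)

theorem map_relQuadratic_eq_zero_iff (ha : ∀ i : Fin (d + 1), f (.X (.a i)) = a i) :
    (∀ r ∈ relQuadratic d, f r = 0) ↔
      ∀ i m n, i + m + n + 2 = d → a i * a (i + m + 2) - a (i + 1) * a (i + m + 1)
        = (f (.X .eu) ^ 2 - 4 * f (.X .q) * f (.X .Q)) * f (.X .q) ^ n * f (.X .Q) ^ i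
          * aeval ![f (.X .eu), f (.X .q), f (.X .Q)] (Psi m) := by
  constructor
  · intro h i m n hd
    have hn : d - (i + m + 1) - 1 = n := by lia
    have hm : i + m + 1 - (i + 1) = m := by lia
    have := h _ ⟨i + 1, i + m + 1, by lia, by lia, by lia, rfl⟩
    simpa only [map_sub, map_mul, map_pow, map_ofNat, map_aeval_Psi, ha, sub_eq_zero,
      Nat.add_sub_cancel, hn, hm] using this
  · rintro h _ ⟨i, j, h1, hij, hj, rfl⟩
    obtain ⟨i, rfl⟩ := Nat.exists_eq_add_of_le' h1
    obtain ⟨m, rfl⟩ := Nat.exists_eq_add_of_le hij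
    have hm : i + m + 1 - (i + 1) = m := by lia
    have := h i m (d - (i + m + 1) - 1) (by lia)
    simpa only [map_sub, map_mul, map_pow, map_ofNat, map_aeval_Psi, ha, sub_eq_zero,
      Nat.add_sub_cancel, hm, add_right_comm i 1 m] using this

theorem span_le_ker_iff_dihedralRelations (ha : ∀ i : Fin (d + 1), f (.X (.a i)) = a i) :
    Ideal.span (relLinear d ∪ relQuadratic d) ≤ RingHom.ker f ↔
      DihedralRelations d (f (.X .q)) (f (.X .Q)) (f (.X .eu)) a := by
  rw [Ideal.span_le, Set.union_subset_iff]
  refine (and_congr (map_relLinear_eq_zero_iff ha) (map_relQuadratic_eq_zero_iff ha)).trans ?_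
  exact ⟨fun h => ⟨h.1, h.2⟩, fun h => ⟨h.linear, h.quadratic⟩⟩

theorem span_le_ker (d : ℕ) : Ideal.span (relLinear d ∪ relQuadratic d)
    ≤ RingHom.ker (aeval (R := ℂ) (Gen.toPoly (d := d))) :=
  (span_le_ker_iff_dihedralRelations fun _ => aeval_X _ _).2 <| by
    simpa only [aeval_X, Gen.toPoly] using dihedralRelations_poly d

end Relations

section Spanning

variable {P B : Type*} [CommRing P] [CommRing B] [Algebra P B]

/-- The family `1, e, …, e ^ d, a 1, …, a (d - 1)`, which spans an algebra over the parameters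
`q, Q, a 0, a d` as soon as the relations of the presentation hold. -/
def spanningFamily (d : ℕ) (e : B) (a : ℕ → B) : Fin (d + 1) ⊕ Fin (d - 1) → B :=
  Sum.elim (fun j => e ^ (j : ℕ)) fun i => a (i + 1)

/-- The span of `spanningFamily d e a` over `P`. -/
def familySpan (P : Type*) [CommRing P] [Algebra P B] (d : ℕ) (e : B) (a : ℕ → B) :
    Submodule P B :=
  Submodule.span P (Set.range (spanningFamily d e a))

variable {d : ℕ} {e : B} {a : ℕ → B}

theorem pow_mem_familySpan {j : ℕ} (hj : j ≤ d) : e ^ j ∈ familySpan P d e a :=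
  Submodule.subset_span ⟨.inl ⟨j, by lia⟩, rfl⟩

theorem one_mem_familySpan : 1 ∈ familySpan P d e a := by
  simpa using pow_mem_familySpan (P := P) (e := e) (a := a) d.zero_le

theorem mem_familySpan (h0 : a 0 ∈ (⊥ : Subalgebra P B)) (hd : a d ∈ (⊥ : Subalgebra P B))
    {i : ℕ} (hi : i ≤ d) : a i ∈ familySpan P d e a := by
  rcases i with _ | i
  · simpa using mul_mem_of_mem_bot h0 one_mem_familySpan
  rcases hi.eq_or_lt with rfl | hlt
  · simpa using mul_mem_of_mem_bot hd one_mem_familySpan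
  · exact Submodule.subset_span ⟨.inr ⟨i, by lia⟩, rfl⟩

theorem isMonicOfDegree_aeval_Psi [Nontrivial P] [Algebra ℂ P] (q Q : P) (n : ℕ) :
    (aeval ![Polynomial.X, Polynomial.C q, Polynomial.C Q] (Psi n)).IsMonicOfDegree n := by
  induction n using Nat.twoStepInduction with
  | zero => simp [Psi]
  | one => simpa [Psi] using Polynomial.isMonicOfDegree_X P
  | more n h0 h1 =>
    have hrec : aeval ![Polynomial.X, Polynomial.C q, Polynomial.C Q] (Psi (n + 2))
        = Polynomial.X * aeval ![Polynomial.X, Polynomial.C q, Polynomial.C Q] (Psi (n + 1))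
          - Polynomial.C (q * Q)
            * aeval ![Polynomial.X, Polynomial.C q, Polynomial.C Q] (Psi n) := by
      simp [Psi]
    rw [hrec]
    have hlead := (Polynomial.isMonicOfDegree_X P).mul h1
    rw [show 1 + (n + 1) = n + 2 by ring] at hlead
    refine hlead.sub ((Polynomial.natDegree_C_mul_le _ _).trans_lt ?_)
    rw [h0.natDegree_eq]
    lia

variable [Algebra ℂ P] [Algebra ℂ B] [IsScalarTower ℂ P B]

theorem aeval_aeval_Psi (q Q : P) (e : B) (n : ℕ) :
    Polynomial.aeval e (aeval ![Polynomial.X, Polynomial.C q, Polynomial.C Q] (Psi n))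
      = aeval ![e, algebraMap P B q, algebraMap P B Q] (Psi n) := by
  change (Polynomial.aeval e).restrictScalars ℂ _ = _
  rw [← AlgHom.comp_apply, comp_aeval]
  congr 2
  ext i
  fin_cases i <;> simp

/-- The polynomial `(T ^ 2 - 4 q Q) Ψ_n (T, q, Q)` in `T`, whose value at `eu` occurs in the
quadratic relations. -/
noncomputable def discrPsi (q Q : P) (n : ℕ) : Polynomial P :=
  (Polynomial.X ^ 2 - Polynomial.C (4 * q * Q))
    * aeval ![Polynomial.X, Polynomial.C q, Polynomial.C Q] (Psi n)

theorem isMonicOfDegree_discrPsi [Nontrivial P] (q Q : P) (n : ℕ) :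
    (discrPsi q Q n).IsMonicOfDegree (n + 2) := by
  rw [add_comm]
  refine .mul (.sub (Polynomial.isMonicOfDegree_X_pow P 2) ?_) (isMonicOfDegree_aeval_Psi q Q n)
  rw [Polynomial.natDegree_C]
  exact two_pos

theorem aeval_discrPsi (q Q : P) (e : B) (n : ℕ) : Polynomial.aeval e (discrPsi q Q n)
    = (e ^ 2 - 4 * algebraMap P B q * algebraMap P B Q)
      * aeval ![e, algebraMap P B q, algebraMap P B Q] (Psi n) := by
  rw [discrPsi, map_mul, aeval_aeval_Psi, map_sub, map_pow, Polynomial.aeval_X,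
    Polynomial.aeval_C, map_mul, map_mul, map_ofNat]

namespace DihedralRelations

variable {q Q : P} (h : DihedralRelations d (algebraMap P B q) (algebraMap P B Q) e a)
include h

theorem quadratic_mem [Nontrivial P] {i m n : ℕ} (hi : i + m + n + 2 = d) :
    a i * a (i + m + 2) - a (i + 1) * a (i + m + 1) ∈ familySpan P d e a := by
  have hquad := h.quadratic i m n hi
  rw [mul_right_comm, mul_right_comm _ (_ ^ n), ← aeval_discrPsi, mul_assoc, ← map_pow, ← map_pow,
    ← map_mul, mul_comm (Polynomial.aeval e _), ← Algebra.smul_def] at hquad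
  rw [hquad]
  refine Submodule.smul_mem _ _ (aeval_mem_of_natDegree_lt (n := d + 1)
    (fun j hj => pow_mem_familySpan (Nat.lt_succ_iff.1 hj)) ?_)
  rw [(isMonicOfDegree_discrPsi q Q m).natDegree_eq]
  lia

variable (h0 : a 0 ∈ (⊥ : Subalgebra P B)) (hd : a d ∈ (⊥ : Subalgebra P B))
include h0 hd

omit [Algebra ℂ P] [IsScalarTower ℂ P B] in
theorem pow_mul_mem {i j : ℕ} (hi : i ≤ d) (hj : j ≤ d) :
    e ^ j * a i ∈ familySpan P d e a := by
  induction j generalizing i with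
  | zero => simpa using mem_familySpan h0 hd hi
  | succ j ih =>
    rcases i with _ | i
    · exact mul_comm (a 0) _ ▸ mul_mem_of_mem_bot h0 (pow_mem_familySpan hj)
    rcases hi.eq_or_lt with rfl | hlt
    · exact mul_comm (a (i + 1)) _ ▸ mul_mem_of_mem_bot hd (pow_mem_familySpan hj)
    rw [pow_succ, mul_assoc, h.linear i hlt, mul_add, ← Algebra.smul_def, ← Algebra.smul_def,
      mul_smul_comm, mul_smul_comm]
    exact add_mem (Submodule.smul_mem _ _ (ih hlt (by lia)))
      (Submodule.smul_mem _ _ (ih (by lia) (by lia)))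

theorem mul_mem_of_le [Nontrivial P] {i j : ℕ} (hij : i ≤ j) (hj : j ≤ d) :
    a i * a j ∈ familySpan P d e a := by
  induction i generalizing j with
  | zero => exact mul_mem_of_mem_bot h0 (mem_familySpan h0 hd hj)
  | succ i ih =>
    rcases hj.eq_or_lt with rfl | hlt
    · exact mul_comm (a j) _ ▸ mul_mem_of_mem_bot hd (mem_familySpan h0 hd hij)
    obtain ⟨m, rfl⟩ := Nat.exists_eq_add_of_le hij
    rw [← sub_sub_cancel (a i * a (i + m + 2)) (a (i + 1) * a (i + 1 + m)), add_right_comm i 1 m]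
    refine sub_mem (ih (by lia) (by lia)) ?_
    exact h.quadratic_mem (n := d - (i + m + 2)) (by lia)

theorem mul_mem [Nontrivial P] {i j : ℕ} (hi : i ≤ d) (hj : j ≤ d) :
    a i * a j ∈ familySpan P d e a := by
  rcases le_total i j with hij | hij
  · exact h.mul_mem_of_le h0 hd hij hj
  · exact mul_comm (a j) _ ▸ h.mul_mem_of_le h0 hd hij hi

theorem pow_succ_mem [Nontrivial P] (h2 : 2 ≤ d) : e ^ (d + 1) ∈ familySpan P d e a := by
  obtain ⟨m, rfl⟩ := Nat.exists_eq_add_of_le' h2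
  have hF := (Polynomial.isMonicOfDegree_X P).mul (isMonicOfDegree_discrPsi q Q m)
  rw [add_comm 1] at hF
  refine pow_mem_of_aeval_mem (fun j hj => pow_mem_familySpan (Nat.lt_succ_iff.1 hj))
    (Nat.succ_ne_zero _) hF ?_
  have hquad := h.quadratic 0 m 0 (by lia)
  rw [pow_zero, pow_zero, mul_one, mul_one, ← aeval_discrPsi] at hquad
  rw [map_mul, Polynomial.aeval_X, ← hquad, mul_sub, mul_left_comm, ← mul_assoc e,
    h.linear 0 (by lia), add_mul, mul_assoc, mul_assoc, zero_add, zero_add]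
  refine sub_mem (mul_mem_of_mem_bot h0 ?_) (add_mem (mul_mem_of_mem_bot ⟨q, rfl⟩ ?_)
    (mul_mem_of_mem_bot ⟨Q, rfl⟩ ?_))
  · simpa using h.pow_mul_mem h0 hd le_rfl (j := 1) (by lia)
  · exact h.mul_mem h0 hd (by lia) (by lia)
  · exact h.mul_mem h0 hd (by lia) (by lia)

theorem eu_mul_spanningFamily_mem [Nontrivial P] (h2 : 2 ≤ d)
    (k : Fin (d + 1) ⊕ Fin (d - 1)) : e * spanningFamily d e a k ∈ familySpan P d e a := by
  rcases k with j | i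
  · change e * e ^ (j : ℕ) ∈ _
    rw [← pow_succ']
    rcases j.is_le.eq_or_lt with hj | hj
    · rw [hj]
      exact h.pow_succ_mem h0 hd h2
    · exact pow_mem_familySpan hj
  · change e * a (i + 1) ∈ _
    simpa using h.pow_mul_mem h0 hd (i := i + 1) (j := 1) (by lia) (by lia)

theorem mul_spanningFamily_mem [Nontrivial P] {i : ℕ} (hi : i ≤ d)
    (k : Fin (d + 1) ⊕ Fin (d - 1)) : a i * spanningFamily d e a k ∈ familySpan P d e a := by
  rcases k with j | l
  · exact mul_comm (e ^ (j : ℕ)) _ ▸ h.pow_mul_mem h0 hd hi j.is_le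
  · exact h.mul_mem h0 hd hi (by lia)

theorem familySpan_eq_top [Nontrivial P] (h2 : 2 ≤ d) {f : Gen d → B}
    (hf : Algebra.adjoin ℂ (Set.range f) = ⊤) (hq : f .q = algebraMap P B q)
    (hQ : f .Q = algebraMap P B Q) (he : f .eu = e) (ha : ∀ i : Fin (d + 1), f (.a i) = a i) :
    familySpan P d e a = ⊤ := by
  refine span_eq_top_of_forall_mul_mem hf one_mem_familySpan ?_
  rintro _ ⟨g, rfl⟩ _ ⟨k, rfl⟩
  have hk : spanningFamily d e a k ∈ familySpan P d e a := Submodule.subset_span ⟨k, rfl⟩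
  cases g with
  | q => exact mul_mem_of_mem_bot ⟨q, hq.symm⟩ hk
  | Q => exact mul_mem_of_mem_bot ⟨Q, hQ.symm⟩ hk
  | eu => exact he ▸ h.eu_mul_spanningFamily_mem h0 hd h2 k
  | a i => exact ha i ▸ h.mul_spanningFamily_mem h0 hd i.is_le k

end DihedralRelations

end Spanning

section Kernel

theorem exists_mul_eq_and_pow_add_pow_eq {K : Type*} [Field K] [IsAlgClosed K] {d : ℕ}
    (hd : d ≠ 0) (p w : K) : ∃ u v : K, u * v = p ∧ u ^ d + v ^ d = w := by
  -- `u ^ d` and `v ^ d` have to be the roots of `T ^ 2 - w T + p ^ d`.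
  obtain ⟨t, ht⟩ := IsAlgClosed.exists_root
    (Polynomial.X ^ 2 - Polynomial.C w * Polynomial.X + Polynomial.C (p ^ d))
    (ne_of_eq_of_ne (by compute_degree!) two_ne_zero)
  replace ht : t ^ 2 - w * t + p ^ d = 0 := by simpa [Polynomial.IsRoot.def] using ht
  obtain ⟨u, rfl⟩ := IsAlgClosed.exists_pow_nat_eq t (Nat.pos_of_ne_zero hd)
  rcases eq_or_ne u 0 with rfl | hu
  · obtain ⟨v, hv⟩ := IsAlgClosed.exists_pow_nat_eq w (Nat.pos_of_ne_zero hd)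
    have hp : p = 0 := by simpa [hd] using ht
    exact ⟨0, v, by rw [hp, zero_mul], by rw [hv, zero_pow hd, zero_add]⟩
  · refine ⟨u, p / u, mul_div_cancel₀ p hu, ?_⟩
    rw [div_pow]
    field_simp
    linear_combination ht

/-- The generators `q, Q, a_0, a_d`, whose values in `ℂ[V × V*]` are algebraically independent. -/
def parameters (d : ℕ) : Set (Gen d) := {.q, .Q, .a 0, .a (Fin.last d)}

/-- The ring of polynomials in the generators `q, Q, a_0, a_d`. -/
abbrev ParameterRing (d : ℕ) : Type := MvPolynomial (parameters d) ℂ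

variable {d : ℕ}

theorem algebraicIndependent_parameters (hd : d ≠ 0) :
    AlgebraicIndependent ℂ fun i : parameters d => (i : Gen d).toPoly := by
  refine algebraicIndependent_of_forall_exists_eval_eq
    (f := fun i : parameters d => (i : Gen d).toPoly) fun w => ?_
  obtain ⟨u, v, hmul, hadd⟩ := exists_mul_eq_and_pow_add_pow_eq hd
    (w ⟨.q, by simp [parameters]⟩) (w ⟨.a 0, by simp [parameters]⟩)
  obtain ⟨u', v', hmul', hadd'⟩ := exists_mul_eq_and_pow_add_pow_eq hd
    (w ⟨.Q, by simp [parameters]⟩) (w ⟨.a (Fin.last d), by simp [parameters]⟩)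
  refine ⟨Sum.elim ![u, v] ![u', v'], ?_⟩
  rintro ⟨_, rfl | rfl | rfl | rfl⟩
  · simpa [Gen.toPoly, q, x, y] using hmul
  · simpa [Gen.toPoly, Q, X, Y] using hmul'
  · simpa [Gen.toPoly, a, x, y] using hadd
  · simpa [Gen.toPoly, a, X, Y, add_comm] using hadd'

noncomputable local instance : Algebra (ParameterRing d) (MvPolynomial (Gen d) ℂ) :=
  (rename (R := ℂ) ((↑) : parameters d → Gen d)).toAlgebra

noncomputable local instance : Algebra (ParameterRing d) Poly :=
  (aeval (R := ℂ) fun i : parameters d => (i : Gen d).toPoly).toAlgebra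

local instance : IsScalarTower ℂ (ParameterRing d) (MvPolynomial (Gen d) ℂ) :=
  .of_algebraMap_eq' (rename (R := ℂ) ((↑) : parameters d → Gen d)).comp_algebraMap.symm

theorem faithfulSMul_parameterRing (hd : d ≠ 0) : FaithfulSMul (ParameterRing d) Poly :=
  (faithfulSMul_iff_algebraMap_injective _ _).2 (algebraicIndependent_parameters hd)

/-- The substitution `x ↦ u, y ↦ v`, as a homomorphism over the parameters `q, Q, a_0, a_d`, which
it is required to fix. -/
noncomputable def substXY (u v : Poly) (hmul : u * v = q) (hpow : u ^ d + v ^ d = a d 0) :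
    Poly →ₐ[ParameterRing d] Poly :=
  { aeval (R := ℂ) (Sum.elim ![u, v] ![X, Y]) with
    commutes' := fun p => by
      change (aeval (R := ℂ) (Sum.elim ![u, v] ![X, Y])).comp
        (aeval fun i : parameters d => (i : Gen d).toPoly) p = aeval _ p
      congr 1
      refine MvPolynomial.algHom_ext ?_
      rintro ⟨_, rfl | rfl | rfl | rfl⟩
      · simpa [Gen.toPoly, q, x, y] using hmul
      · simp [Gen.toPoly, Q, X, Y]
      · simpa [Gen.toPoly, a, x, y] using hpow
      · simp [Gen.toPoly, a, X, Y] }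

theorem substXY_eu {u v : Poly} (hmul : u * v = q) (hpow : u ^ d + v ^ d = a d 0) :
    substXY u v hmul hpow eu = u * X + v * Y := by
  change aeval (R := ℂ) (Sum.elim ![u, v] ![X, Y]) eu = _
  simp [eu, x, y, X, Y]

variable {ζ : ℂ}

/-- The `2 * d` images of `(x, y)` under the dihedral group generated by `s ζ 0` and `s ζ 1`. -/
noncomputable def dihedralOrbit (ζ : ℂ) (d : ℕ) : Fin d ⊕ Fin d → Poly × Poly :=
  Sum.elim (fun k => (C (ζ ^ (k : ℕ)) * x, C (ζ⁻¹ ^ (k : ℕ)) * y))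
    fun k => (C (ζ ^ (k : ℕ)) * y, C (ζ⁻¹ ^ (k : ℕ)) * x)

theorem dihedralOrbit_mul (hζ : ζ ≠ 0) (k : Fin d ⊕ Fin d) :
    (dihedralOrbit ζ d k).1 * (dihedralOrbit ζ d k).2 = q := by
  have hinv (k : ℕ) : (C (ζ ^ k) * C (ζ⁻¹ ^ k) : Poly) = 1 := by
    rw [← C_mul, ← mul_pow, mul_inv_cancel₀ hζ, one_pow, C_1]
  rcases k with k | k <;> simp only [dihedralOrbit, Sum.elim_inl, Sum.elim_inr, q] <;>
    linear_combination x * y * hinv k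

theorem dihedralOrbit_pow_add_pow (hζ : ζ ^ d = 1) (k : Fin d ⊕ Fin d) :
    (dihedralOrbit ζ d k).1 ^ d + (dihedralOrbit ζ d k).2 ^ d = a d 0 := by
  have hpow (k : ℕ) : (C (ζ ^ k) : Poly) ^ d = 1 := by
    rw [← C_pow, pow_right_comm, hζ, one_pow, C_1]
  have hpow' (k : ℕ) : (C (ζ⁻¹ ^ k) : Poly) ^ d = 1 := by
    rw [← C_pow, pow_right_comm, inv_pow, hζ, inv_one, one_pow, C_1]
  rcases k with k | k <;>
    simp only [dihedralOrbit, Sum.elim_inl, Sum.elim_inr, a, Nat.sub_zero, mul_pow, hpow,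
      hpow'] <;> ring

theorem dihedralOrbit_conjugates_injective (hζ : IsPrimitiveRoot ζ d) :
    Function.Injective fun k => (dihedralOrbit ζ d k).1 * X + (dihedralOrbit ζ d k).2 * Y := by
  have hpow {k l : Fin d} (h : ζ ^ (k : ℕ) = ζ ^ (l : ℕ)) : k = l :=
    Fin.ext (hζ.pow_inj k.2 l.2 h)
  intro k l h
  have hx := congrArg (eval (Sum.elim ![1, 0] ![1, 0])) h
  have hy := congrArg (eval (Sum.elim ![0, 1] ![1, 0])) h
  have hne (k : Fin d) : ζ ^ (k : ℕ) ≠ 0 := pow_ne_zero _ (hζ.ne_zero (Nat.ne_zero_of_lt k.2))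
  rcases k with k | k <;> rcases l with l | l
  · exact congrArg _ (hpow (by simpa [dihedralOrbit, x, y, X, Y] using hx))
  · exact absurd (by simpa [dihedralOrbit, x, y, X, Y] using hx) (hne k)
  · exact absurd (by simpa [dihedralOrbit, x, y, X, Y] using hy) (hne k)
  · exact congrArg _ (hpow (by simpa [dihedralOrbit, x, y, X, Y] using hy))

theorem linearIndependent_eu_pow (hd : d ≠ 0) : LinearIndependent (ParameterRing d)
    fun k : Fin (Fintype.card (Fin d ⊕ Fin d)) => eu ^ (k : ℕ) := by
  have hζ := Complex.isPrimitiveRoot_exp d hd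
  have := faithfulSMul_parameterRing hd
  refine linearIndependent_pow_of_injective_conjugates (fun k => substXY _ _
    (dihedralOrbit_mul (hζ.ne_zero hd) k) (dihedralOrbit_pow_add_pow hζ.pow_eq_one k)) ?_
  simpa only [substXY_eu] using dihedralOrbit_conjugates_injective hζ

section Quotient

variable {I : Ideal (MvPolynomial (Gen d) ℂ)}

theorem algebraMap_quotient_X (i : parameters d) :
    algebraMap (ParameterRing d) (MvPolynomial (Gen d) ℂ ⧸ I) (.X i)
      = Ideal.Quotient.mk I (.X (i : Gen d)) := by
  rw [← Ideal.Quotient.mk_algebraMap]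
  exact congrArg _ (rename_X _ i)

theorem dihedralRelations_quotient (hI : Ideal.span (relLinear d ∪ relQuadratic d) ≤ I) :
    DihedralRelations d (Ideal.Quotient.mk I (.X .q)) (Ideal.Quotient.mk I (.X .Q))
      (Ideal.Quotient.mk I (.X .eu))
      (fun i => Ideal.Quotient.mk I (.X (.a (Fin.ofNat (d + 1) i)))) := by
  refine (span_le_ker_iff_dihedralRelations (f := Ideal.Quotient.mkₐ ℂ I) (fun i => ?_)).1
    fun r hr => Ideal.Quotient.eq_zero_iff_mem.2 (hI hr)
  rw [Fin.ofNat_val_eq_self]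
  rfl

theorem familySpan_quotient_eq_top (hd : 2 ≤ d)
    (hI : Ideal.span (relLinear d ∪ relQuadratic d) ≤ I) :
    familySpan (ParameterRing d) d (Ideal.Quotient.mk I (.X .eu))
      (fun i => Ideal.Quotient.mk I (.X (.a (Fin.ofNat (d + 1) i)))) = ⊤ := by
  have hrel := dihedralRelations_quotient hI
  have hq := algebraMap_quotient_X (I := I) ⟨.q, by simp [parameters]⟩
  have hQ := algebraMap_quotient_X (I := I) ⟨.Q, by simp [parameters]⟩
  have h0 := algebraMap_quotient_X (I := I) ⟨.a 0, by simp [parameters]⟩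
  have hlast := algebraMap_quotient_X (I := I) ⟨.a (Fin.last d), by simp [parameters]⟩
  rw [← hq, ← hQ] at hrel
  refine hrel.familySpan_eq_top ⟨_, h0⟩ ⟨_, hlast.trans ?_⟩ hd
    (adjoin_range_quotient_mk_X I) hq.symm hQ.symm rfl fun i => ?_
  · rw [Fin.ofNat_eq_cast, Fin.natCast_eq_last]
  · rw [Fin.ofNat_val_eq_self]

end Quotient

/-- The homomorphism of the presentation, over the parameters `q, Q, a_0, a_d`. -/
noncomputable def presentation (d : ℕ) : MvPolynomial (Gen d) ℂ →ₐ[ParameterRing d] Poly :=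
  { aeval (R := ℂ) Gen.toPoly with commutes' := fun p => aeval_rename _ _ p }

theorem ker_eq_span (hd : 2 ≤ d) : RingHom.ker (aeval (R := ℂ) (Gen.toPoly (d := d)))
    = Ideal.span (relLinear d ∪ relQuadratic d) := by
  refine le_antisymm (fun f hf => ?_) (span_le_ker d)
  let I := Ideal.span (relLinear d ∪ relQuadratic d)
  let π : (MvPolynomial (Gen d) ℂ ⧸ I) →ₐ[ParameterRing d] Poly :=
    Ideal.Quotient.liftₐ I (presentation d) (span_le_ker d)
  let v (k : Fin (Fintype.card (Fin d ⊕ Fin d))) := Ideal.Quotient.mk I (.X .eu ^ (k : ℕ))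
  have hπv : π.toLinearMap ∘ v = fun k : Fin _ => eu ^ (k : ℕ) := by
    funext k
    change presentation d (.X .eu ^ (k : ℕ)) = _
    rw [map_pow]
    exact congrArg (· ^ (k : ℕ)) (aeval_X _ _)
  have hindep : LinearIndependent (ParameterRing d) (π.toLinearMap ∘ v) := by
    rw [hπv]
    exact linearIndependent_eu_pow (by lia)
  have hinj : Function.Injective π := by
    refine injective_of_span_eq_top_of_linearIndependent
      (familySpan_quotient_eq_top hd (le_refl I)) π.toLinearMap hindep ?_
    simp only [Fintype.card_sum, Fintype.card_fin]
    lia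
  have hf0 : π (Ideal.Quotient.mk I f) = π 0 := by
    rw [map_zero]
    exact hf
  exact Ideal.Quotient.eq_zero_iff_mem.1 (hinj hf0)

end Kernel

end DihedralInvariants

theorem mainTheorem7 (d : ℕ) (hd : 2 ≤ d) (ζ : ℂˣ) (hζ : IsPrimitiveRoot ζ d) :
    (MvPolynomial.aeval (R := ℂ) (DihedralInvariants.Gen.toPoly (d := d))).range
        = DihedralInvariants.invariants (DihedralInvariants.W ζ) ∧
    RingHom.ker (MvPolynomial.aeval (R := ℂ) (DihedralInvariants.Gen.toPoly (d := d)))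
        = Ideal.span (DihedralInvariants.relLinear d ∪ DihedralInvariants.relQuadratic d) :=
  ⟨DihedralInvariants.range_eq_invariants hζ, DihedralInvariants.ker_eq_span hd⟩
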